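/- \textbf{Setting.} Let $\mathit{Var}$ be a finite set of variables. A VASS $V$ consists of a finite set $St(V)$ of states and a finite set $Trns(V)\subseteq St(V)\times\mathbb Z^{\mathit{Var}}\times St(V)$ of transitions $t=(s,d,s')$. $V$ is connected if for all states $s,s'$ there is a (possibly empty) path from $s$ to $s'$. $V'$ is a sub-VASS of $V$ if $St(V')\subseteq St(V)$ and $Trns(V')\subseteq Trns(V)$. An SCC of $V$ is a maximal sub-VASS of $V$ among those that are connected and have at least one transition. Let $D(x,t)=d(x)$ for $t=(s,d,s')$ be the update matrix, and let $F\in\mathbb Z^{St(V)\times Trns(V)}$ be the flow matrix: the column of $t=(s,d,s')$ is $0$ if $s=s'$; otherwise it has entry $-1$ at $s$, $+1$ at $s'$ and $0$ elsewhere. \textbf{Algorithm 1.} Let $V$ be a connected VASS. The algorithm maintains a rooted tree whose nodes $\eta$ are labelled by sub-VASSs $v(\eta)$ of $V$; $\mathrm{layer}(i)$ is the set of nodes at distance $i$ from the root. Initially the tree consists of the root $\iota$ with $v(\iota)=V$, $\ell=1$, and $\mathtt{vExp}(x)=\mathtt{tExp}(t)=\infty$ for all $x\in\mathit{Var}$,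 $t\in Trns(V)$. One loop iteration does the following. 1. Let $U=\bigcup_{\eta\in\mathrm{layer}(\ell-1)}Trns(v(\eta))$ and $\mathit{Var}_{ext}=\{(x,\eta)\mid x\in\mathit{Var},\ \eta\in\mathrm{layer}(\ell-\mathtt{vExp}(x))\}$, where $n-\infty=0$. Let $D_{ext}\in\mathbb Z^{\mathit{Var}_{ext}\times U}$ with $D_{ext}((x,\eta),t)=D(x,t)$ if $t\in Trns(v(\eta))$ and $0$ otherwise. 2. Among all $r\in\mathbb Z^{\mathit{Var}_{ext}}$, $z\in\mathbb Z^{St(V)}$ with $r\ge0$, $z\ge0$, $D_{ext}^Tr+F|_U^Tz\le0$, choose any that maximize the number of strict inequalities $r(x,\eta)>0$ and $(D_{ext}^Tr+F|_U^Tz)(t)<0$. 3. Let $R=\{t\in U\mid(D_{ext}^Tr+F|_U^Tz)(t)<0\}$. Set $\mathtt{tExp}(t):=\ell$ for all $t\in R$. For every $\eta\in\mathrm{layer}(\ell-1)$ and every SCC $S$ of $(St(v(\eta)),Trns(v(\eta))\setminus R)$, create a child of $\eta$ labelled by $S$. For every $x$ with $\mathtt{vExp}(x)=\infty$ and $r(x,\iota)>0$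 set $\mathtt{vExp}(x):=\ell$. 4. If there are no $x\in\mathit{Var}$, $t\in Trns(V)$ with $\ell<\mathtt{vExp}(x)+\mathtt{tExp}(t)<\infty$, stop and report "$V$ has at least exponential complexity". 5. Set $\ell:=\ell+1$. If $\mathtt{vExp}(x)\ne\infty$ and $\mathtt{tExp}(t)\ne\infty$ for all $x$ and $t$, terminate with the current $\mathtt{vExp},\mathtt{tExp}$; otherwise start the next iteration. \textbf{Theorem.} Let $V$ be a connected VASS over $\mathit{Var}$. For every run of Algorithm 1 on $V$ (i.e., for every choice of the optimal solutions in step 2) that terminates without reporting exponential complexity, the computed exponents satisfy $$\mathtt{vExp}(x)\le2^{|\mathit{Var}|}\ \text{ for all }x\in\mathit{Var}\qquad\text{and}\qquad\mathtt{tExp}(t)\le2^{|\mathit{Var}|}\ \text{ for all }t\in Trns(V).$$ -/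

import Mathlib

noncomputable section

namespace VASSBounds

/-- A transition `s₁ --u--> s₂` over states `Q` and variables `Var`: source, update, target. -/
abbrev Transition (Q Var : Type*) := Q × (Var → ℤ) × Q

/-- A vector addition system with states (VASS): a finite set of states and a finite set of
transitions between these states. -/
@[ext]
structure VASS (Q Var : Type*) where
  states : Finset Q
  transitions : Finset (Transition Q Var)
  src_mem : ∀ t ∈ transitions, t.1 ∈ states
  tgt_mem : ∀ t ∈ transitions, t.2.2 ∈ states

variable {Q Var : Type*}

namespace VASS

/-- There is an edge (a transition with some update) from `s` to `s'`. -/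
def Edge (V : VASS Q Var) (s s' : Q) : Prop :=
  ∃ u : Var → ℤ, (s, u, s') ∈ V.transitions

/-- Every state can be reached from every state by a (possibly empty) path. -/
def Connected (V : VASS Q Var) : Prop :=
  ∀ s ∈ V.states, ∀ s' ∈ V.states, Relation.ReflTransGen V.Edge s s'

/-- `C` is a sub-VASS of `V`. -/
def IsSubVASS (C V : VASS Q Var) : Prop :=
  C.states ⊆ V.states ∧ C.transitions ⊆ V.transitions

/-- `C` is a strongly connected component of `V`: a maximal sub-VASS among those that are connected
and have at least one transition. -/
def IsSCC (C V : VASS Q Var) : Prop :=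
  C.IsSubVASS V ∧ C.Connected ∧ C.transitions.Nonempty ∧
    ∀ C' : VASS Q Var, C'.IsSubVASS V → C'.Connected → C'.transitions.Nonempty →
      C.IsSubVASS C' → C'.IsSubVASS C

theorem finite_subVASS (V : VASS Q Var) : {C : VASS Q Var | C.IsSubVASS V}.Finite := by
  refine Set.Finite.of_finite_image (f := fun C : VASS Q Var => (C.states, C.transitions))
    ((V.states.powerset ×ˢ V.transitions.powerset).finite_toSet.subset ?_) ?_
  · rintro _ ⟨C, hC, rfl⟩
    simp only [Finset.mem_coe, Finset.mem_product, Finset.mem_powerset]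
    exact hC
  · intro C _ C' _ h
    simp only [Prod.mk.injEq] at h
    exact VASS.ext h.1 h.2

theorem finite_scc (V : VASS Q Var) : {C : VASS Q Var | C.IsSCC V}.Finite :=
  V.finite_subVASS.subset fun _ h => h.1

/-- The finite set of strongly connected components of `V`. -/
def sccs (V : VASS Q Var) : Finset (VASS Q Var) := V.finite_scc.toFinset

open Classical in
/-- Remove the transitions in `R`, keeping all states. -/
def removeTransitions (V : VASS Q Var) (R : Finset (Transition Q Var)) : VASS Q Var where
  states := V.states
  transitions := V.transitions \ R
  src_mem t ht := V.src_mem t (Finset.mem_sdiff.1 ht).1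
  tgt_mem t ht := V.tgt_mem t (Finset.mem_sdiff.1 ht).1

end VASS

/-- Nodes of the rooted tree that the algorithm builds. A node is the list of the labels on the
path from the node (head) up to, but excluding, the root: the root is `[]`, and the child of `η`
that is created for the component `C` is `C :: η`. The distance of a node to the root is its
length, its parent is its tail, and its ancestors are its suffixes. -/
abbrev Node (Q Var : Type*) := List (VASS Q Var)

/-- The sub-VASS of `V` that labels a node; the root is labelled by `V`. -/
def label (V : VASS Q Var) (η : Node Q Var) : VASS Q Var := η.headD V

/-- The data maintained by the algorithm: the next layer `ℓ` to be added, the set of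
nodes of the tree, and the exponents found so far, with `⊤` for "not yet known". -/
structure AlgState (V : VASS Q Var) where
  ℓ : ℕ
  tree : Finset (Node Q Var)
  vExp : Var → ℕ∞
  tExp : V.transitions → ℕ∞

namespace AlgState

variable {V : VASS Q Var}

/-- The initial state: the tree has only its root, `ℓ = 1`, and no exponent is known. -/
def init (V : VASS Q Var) : AlgState V where
  ℓ := 1
  tree := {[]}
  vExp _ := ⊤
  tExp _ := ⊤

/-- The nodes at distance `i` to the root. -/
def layer (σ : AlgState V) (i : ℕ) : Finset (Node Q Var) :=
  σ.tree.filter fun η => η.length = i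

open Classical in
/-- The set `U` of the transitions that occur in layer `ℓ - 1`. -/
def U (σ : AlgState V) : Finset (Transition Q Var) :=
  (σ.layer (σ.ℓ - 1)).biUnion fun η => (label V η).transitions

open Classical in
/-- The extended variables: pairs of a variable `x` and a node in layer `ℓ - vExp x`, where
`ℓ - ∞ = 0` (which is the value of this subtraction in `ℕ∞`). -/
def varExt [Fintype Var] (σ : AlgState V) : Finset (Var × Node Q Var) :=
  (Finset.univ ×ˢ σ.tree).filter fun p => (p.2.length : ℕ∞) = (σ.ℓ : ℕ∞) - σ.vExp p.1

open Classical in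
/-- The extended update matrix: the entry at `((x, η), t)` is the update of `x` by `t` if `t`
belongs to the label of `η`, and `0` otherwise. -/
def extUpdateMatrix [Fintype Var] (σ : AlgState V) : Matrix σ.varExt σ.U ℤ :=
  Matrix.of fun p t => if t.1 ∈ (label V p.1.2).transitions then t.1.2.1 p.1.1 else 0

open Classical in
/-- The flow matrix of `V`, restricted to the columns in `U`. -/
def flowMatrix (σ : AlgState V) : Matrix V.states σ.U ℤ :=
  Matrix.of fun s t =>
    if t.1.1 = t.1.2.2 then 0
    else if s.1 = t.1.1 then -1
    else if s.1 = t.1.2.2 then 1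
    else 0

/-- The vector `D_extᵀ r + F|_Uᵀ z`. -/
def change [Fintype Var] (σ : AlgState V) (r : σ.varExt → ℤ) (z : V.states → ℤ) : σ.U → ℤ :=
  σ.extUpdateMatrix.transpose.mulVec r + σ.flowMatrix.transpose.mulVec z

/-- `r, z` solve the constraint system of the current iteration:
`r ≥ 0`, `z ≥ 0` and `D_extᵀ r + F|_Uᵀ z ≤ 0`. -/
def IsSolution [Fintype Var] (σ : AlgState V) (r : σ.varExt → ℤ) (z : V.states → ℤ) : Prop :=
  0 ≤ r ∧ 0 ≤ z ∧ σ.change r z ≤ 0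

open Classical in
/-- The objective: the number of strict inequalities `r (x, η) > 0` and
`(D_extᵀ r + F|_Uᵀ z) t < 0`. -/
def objective [Fintype Var] (σ : AlgState V) (r : σ.varExt → ℤ) (z : V.states → ℤ) : ℕ :=
  (Finset.univ.filter fun p => 0 < r p).card +
    (Finset.univ.filter fun t => σ.change r z t < 0).card

/-- `r, z` is an optimal solution of the constraint system of the current iteration. -/
def IsOptimal [Fintype Var] (σ : AlgState V) (r : σ.varExt → ℤ) (z : V.states → ℤ) : Prop :=
  σ.IsSolution r z ∧ ∀ r' z', σ.IsSolution r' z' → σ.objective r' z' ≤ σ.objective r z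

open Classical in
/-- The set `R` of the decreasing transitions. -/
def decreasing [Fintype Var] (σ : AlgState V) (r : σ.varExt → ℤ) (z : V.states → ℤ) :
    Finset (Transition Q Var) :=
  (Finset.univ.filter fun t : σ.U => σ.change r z t < 0).image Subtype.val

open Classical in
/-- The children, created for the nodes of layer `ℓ - 1`: one for every strongly connected component
of the label of the node without the decreasing transitions. -/
def newNodes (σ : AlgState V) (R : Finset (Transition Q Var)) : Finset (Node Q Var) :=
  (σ.layer (σ.ℓ - 1)).biUnion fun η =>
    ((label V η).removeTransitions R).sccs.image fun C => C :: η

open Classical in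
/-- The effect of one execution of the loop body with the solution `r, z`, up to (and excluding) the
check for exponential complexity and the increment of `ℓ`. -/
def body [Fintype Var] (σ : AlgState V) (r : σ.varExt → ℤ) (z : V.states → ℤ) : AlgState V where
  ℓ := σ.ℓ
  tree := σ.tree ∪ σ.newNodes (σ.decreasing r z)
  vExp x :=
    if σ.vExp x = ⊤ ∧ ∃ h : (x, []) ∈ σ.varExt, 0 < r ⟨(x, []), h⟩ then (σ.ℓ : ℕ∞) else σ.vExp x
  tExp t := if t.1 ∈ σ.decreasing r z then (σ.ℓ : ℕ∞) else σ.tExp t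

/-- The check after which the algorithm stops with the answer "at least exponential complexity". -/
def ReportsExponential (σ : AlgState V) : Prop :=
  ¬ ∃ (x : Var) (t : V.transitions),
    (σ.ℓ : ℕ∞) < σ.vExp x + σ.tExp t ∧ σ.vExp x + σ.tExp t < ⊤

/-- The exit condition of the loop: all exponents are known. -/
def Done (σ : AlgState V) : Prop :=
  (∀ x, σ.vExp x ≠ ⊤) ∧ ∀ t, σ.tExp t ≠ ⊤

/-- The algorithm's last line of the loop body, `ℓ := ℓ + 1`. -/
def incr (σ : AlgState V) : AlgState V := { σ with ℓ := σ.ℓ + 1 }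

end AlgState

/-- The states that the algorithm, run on `V`, can have at the beginning of an iteration (depending
on which optimal solutions are found). -/
inductive LoopHead [Fintype Var] (V : VASS Q Var) : AlgState V → Prop
  | init : LoopHead V (AlgState.init V)
  | next (σ : AlgState V) (r : σ.varExt → ℤ) (z : V.states → ℤ) (hσ : LoopHead V σ)
      (hopt : σ.IsOptimal r z) (hexp : ¬ (σ.body r z).ReportsExponential)
      (hdone : ¬ (σ.body r z).incr.Done) : LoopHead V (σ.body r z).incr

/-- A run of the algorithm on `V` leaves the loop, without having reported exponential
complexity, and returns the exponents `vExp` and `tExp`. -/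
def Computes [Fintype Var] (V : VASS Q Var) (vExp : Var → ℕ∞) (tExp : V.transitions → ℕ∞) : Prop :=
  ∃ (σ : AlgState V) (r : σ.varExt → ℤ) (z : V.states → ℤ), LoopHead V σ ∧ σ.IsOptimal r z ∧
    ¬ (σ.body r z).ReportsExponential ∧ (σ.body r z).incr.Done ∧
    vExp = (σ.body r z).incr.vExp ∧ tExp = (σ.body r z).incr.tExp

end VASSBounds

end

/-! Let `P` bound the variable exponents found so far, let `k` be their number, and let `known m` be
the set of variables of exponent at most `m`. For a label `S`, `balancing S A` is the space of
coefficients on `A` that suitable state potentials complete to a ranking function constant along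
`S`; `excess S A B` is its codimension in the coordinates `A \ B`. Iterations are charged to
`potential`, the sum of `excess S (known P) (known m)` over `m < P`. The invariant `IsTimed`
provides `s` such that potentials are at most `s`, transition exponents are at most `P + s`, and `2
* (P + s) ≤ 2 ^ k`.

Removing transitions is expensive. A label that has stayed the same for `m` layers is saturated for
`known m` (`Step.isSaturated`): a ranking function on these variables that decreased somewhere would
have been a solution earlier, and optimality would have removed the decreasing transitions. Suppose
iteration `ℓ` finds no variable exponent and removes transitions from a label unchanged since layer
`e`. Then the excess drops for every `m < ℓ - e` (`excess_lt_of_saturated`), so `ℓ` plus the new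
potential is at most `e` plus the old one. This sum never exceeds `P + s`, which bounds `ℓ`.

Suppose iteration `ℓ` finds `d > 0` variable exponents. Then `P` becomes `ℓ`, and each of the `ℓ`
summands grows by at most `d - 1`, since a balancing vector that is positive on the new variables
pays for one dimension (`excess_le_add`). So `s` becomes `s + ℓ * (d - 1)`. Passing the check for
exponential complexity has ensured `ℓ + s ≤ 2 ^ k`, hence `2 * (s + ℓ * d) ≤ (ℓ + s) * (2 * d) ≤ 2 ^
(k + d)`. -/

noncomputable section

namespace VASSBounds

section

variable {Q Var : Type*}

/-! ### Sub-VASSs and strongly connected components -/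

namespace VASS

variable {C D V : VASS Q Var}

theorem IsSubVASS.refl (V : VASS Q Var) : V.IsSubVASS V := ⟨subset_rfl, subset_rfl⟩

theorem IsSubVASS.trans (h : C.IsSubVASS D) (h' : D.IsSubVASS V) : C.IsSubVASS V :=
  ⟨h.1.trans h'.1, h.2.trans h'.2⟩

theorem IsSubVASS.antisymm (h : C.IsSubVASS D) (h' : D.IsSubVASS C) : C = D :=
  VASS.ext (h.1.antisymm h'.1) (h.2.antisymm h'.2)

theorem IsSubVASS.reachable (h : C.IsSubVASS V) {s s' : Q}
    (hs : Relation.ReflTransGen C.Edge s s') : Relation.ReflTransGen V.Edge s s' :=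
  Relation.ReflTransGen.mono (fun _ _ ⟨u, hu⟩ => ⟨u, h.2 hu⟩) _ _ hs

theorem removeTransitions_isSubVASS (V : VASS Q Var) (R : Finset (Transition Q Var)) :
    (V.removeTransitions R).IsSubVASS V :=
  ⟨subset_rfl, by classical exact Finset.sdiff_subset⟩

theorem mem_removeTransitions {R : Finset (Transition Q Var)} {t : Transition Q Var} :
    t ∈ (V.removeTransitions R).transitions ↔ t ∈ V.transitions ∧ t ∉ R := by
  simp [removeTransitions]

theorem mem_sccs : C ∈ V.sccs ↔ C.IsSCC V := by simp [sccs]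

open Classical in
/-- The union of two VASSs. -/
def union (C D : VASS Q Var) : VASS Q Var where
  states := C.states ∪ D.states
  transitions := C.transitions ∪ D.transitions
  src_mem t ht := by
    rcases Finset.mem_union.1 ht with h | h
    · exact Finset.mem_union_left _ (C.src_mem t h)
    · exact Finset.mem_union_right _ (D.src_mem t h)
  tgt_mem t ht := by
    rcases Finset.mem_union.1 ht with h | h
    · exact Finset.mem_union_left _ (C.tgt_mem t h)
    · exact Finset.mem_union_right _ (D.tgt_mem t h)

theorem isSubVASS_union_left (C D : VASS Q Var) : C.IsSubVASS (C.union D) := by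
  classical
  exact ⟨Finset.subset_union_left, Finset.subset_union_left⟩

theorem isSubVASS_union_right (C D : VASS Q Var) : D.IsSubVASS (C.union D) := by
  classical
  exact ⟨Finset.subset_union_right, Finset.subset_union_right⟩

theorem IsSubVASS.union (h : C.IsSubVASS V) (h' : D.IsSubVASS V) : (C.union D).IsSubVASS V := by
  classical
  exact ⟨fun _ hs => (Finset.mem_union.1 hs).elim (h.1 ·) (h'.1 ·),
    fun _ ht => (Finset.mem_union.1 ht).elim (h.2 ·) (h'.2 ·)⟩

theorem Connected.union (hC : C.Connected) (hD : D.Connected) {q : Q} (hqC : q ∈ C.states)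
    (hqD : q ∈ D.states) : (C.union D).Connected := by
  have to_q : ∀ s ∈ (C.union D).states, Relation.ReflTransGen (C.union D).Edge s q ∧
      Relation.ReflTransGen (C.union D).Edge q s := by
    intro s hs
    classical
    rcases Finset.mem_union.1 hs with h | h
    · exact ⟨(isSubVASS_union_left C D).reachable (hC s h q hqC),
        (isSubVASS_union_left C D).reachable (hC q hqC s h)⟩
    · exact ⟨(isSubVASS_union_right C D).reachable (hD s h q hqD),
        (isSubVASS_union_right C D).reachable (hD q hqD s h)⟩
  exact fun s hs s' hs' => (to_q s hs).1.trans (to_q s' hs').2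

theorem IsSCC.isSubVASS_of_mem_states (hC : C.IsSCC V) (hD : D.IsSCC V) {q : Q}
    (hqC : q ∈ C.states) (hqD : q ∈ D.states) : D.IsSubVASS C :=
  (isSubVASS_union_right C D).trans <|
    hC.2.2.2 _ (hC.1.union hD.1) (hC.2.1.union hD.2.1 hqC hqD)
      (hC.2.2.1.mono (isSubVASS_union_left C D).2) (isSubVASS_union_left C D)

/-- Strongly connected components that share a state coincide. -/
theorem IsSCC.eq_of_mem_states (hC : C.IsSCC V) (hD : D.IsSCC V) {q : Q}
    (hqC : q ∈ C.states) (hqD : q ∈ D.states) : C = D :=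
  (hD.isSubVASS_of_mem_states hC hqD hqC).antisymm (hC.isSubVASS_of_mem_states hD hqC hqD)

/-- If no transition of a connected VASS is removed, its only component is the VASS itself. -/
theorem IsSCC.eq_of_disjoint {R : Finset (Transition Q Var)}
    (hC : C.IsSCC (V.removeTransitions R)) (hV : V.Connected)
    (hR : ∀ t ∈ V.transitions, t ∉ R) : C = V := by
  have hVR : V.removeTransitions R = V :=
    VASS.ext rfl (Finset.ext fun t => mem_removeTransitions.trans
      ⟨fun h => h.1, fun h => ⟨h, hR t h⟩⟩)
  rw [hVR] at hC
  exact hC.1.antisymm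
    (hC.2.2.2 V (IsSubVASS.refl V) hV (hC.2.2.1.mono hC.1.2) hC.1)

/-- A potential that does not increase along the transitions of a connected VASS is constant
along them. -/
theorem Connected.potential_eq (hV : V.Connected) {z : Q → ℚ}
    (hz : ∀ t ∈ V.transitions, z t.2.2 ≤ z t.1) {t : Transition Q Var} (ht : t ∈ V.transitions) :
    z t.2.2 = z t.1 := by
  have key : ∀ s s', Relation.ReflTransGen V.Edge s s' → z s' ≤ z s := by
    intro s s' h
    induction h with
    | refl => exact le_rfl
    | tail _ h ih =>
      obtain ⟨u, hu⟩ := h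
      exact (hz _ hu).trans ih
  exact (hz t ht).antisymm (key _ _ (hV _ (V.tgt_mem t ht) _ (V.src_mem t ht)))

end VASS

@[simp] theorem label_nil (V : VASS Q Var) : label V [] = V := rfl

@[simp] theorem label_cons (V C : VASS Q Var) (η : Node Q Var) : label V (C :: η) = C := rfl

/-- The suffix of length `j` of `η`, that is, the ancestor of `η` in layer `j`. -/
def ancestor (η : Node Q Var) (j : ℕ) : Node Q Var := η.drop (η.length - j)

theorem length_ancestor {η : Node Q Var} {j : ℕ} (h : j ≤ η.length) :
    (ancestor η j).length = j := by
  simp only [ancestor, List.length_drop]; omega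

theorem ancestor_cons {η : Node Q Var} {j : ℕ} (h : j ≤ η.length) (C : VASS Q Var) :
    ancestor (C :: η) j = ancestor η j := by
  have : (C :: η).length - j = (η.length - j) + 1 := by simp only [List.length_cons]; omega
  simp only [ancestor, this, List.drop_succ_cons]

theorem tail_ancestor_cons {η : Node Q Var} {j : ℕ} (h : j ≤ η.length) (C : VASS Q Var) :
    (ancestor (C :: η) (j + 1)).tail = ancestor η j := by
  have : (C :: η).length - (j + 1) = η.length - j := by simp only [List.length_cons]; omega
  simp only [ancestor, this, List.tail_drop, List.drop_succ_cons]

/-! ### Drift of linear ranking functions -/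

section Drift

variable [Fintype Var]

/-- The change that the transition `t` causes to the ranking function with coefficients `f` for the
variables and `z` for the states. -/
def drift (f : Var → ℚ) (z : Q → ℚ) (t : Transition Q Var) : ℚ :=
  ∑ x, f x * (t.2.1 x : ℚ) + (z t.2.2 - z t.1)

theorem drift_add (f g : Var → ℚ) (z w : Q → ℚ) (t : Transition Q Var) :
    drift (f + g) (z + w) t = drift f z t + drift g w t := by
  simp only [drift, Pi.add_apply, add_mul, Finset.sum_add_distrib]; ring

theorem drift_smul (c : ℚ) (f : Var → ℚ) (z : Q → ℚ) (t : Transition Q Var) :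
    drift (c • f) (c • z) t = c * drift f z t := by
  simp only [drift, Pi.smul_apply, smul_eq_mul, mul_add, Finset.mul_sum, mul_assoc, mul_sub]

theorem drift_sub (f g : Var → ℚ) (z w : Q → ℚ) (t : Transition Q Var) :
    drift (f - g) (z - w) t = drift f z t - drift g w t := by
  simp only [drift, Pi.sub_apply, sub_mul, Finset.sum_sub_distrib]; ring

theorem drift_zero (z : Q → ℚ) (t : Transition Q Var) :
    drift (0 : Var → ℚ) z t = z t.2.2 - z t.1 := by
  simp [drift]

end Drift

/-! ### Structure of the tree -/

namespace AlgState

variable {V : VASS Q Var} {σ : AlgState V}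

theorem mem_layer {η : Node Q Var} {i : ℕ} : η ∈ σ.layer i ↔ η ∈ σ.tree ∧ η.length = i := by
  simp [layer]

theorem mem_U {t : Transition Q Var} :
    t ∈ σ.U ↔ ∃ η ∈ σ.layer (σ.ℓ - 1), t ∈ (label V η).transitions := by
  simp [U]

theorem mem_newNodes {R : Finset (Transition Q Var)} {η : Node Q Var} :
    η ∈ σ.newNodes R ↔ ∃ C θ, θ ∈ σ.layer (σ.ℓ - 1) ∧
      C.IsSCC ((label V θ).removeTransitions R) ∧ C :: θ = η := by
  simp only [newNodes, Finset.mem_biUnion, Finset.mem_image, VASS.mem_sccs]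
  constructor
  · rintro ⟨θ, h, C, hC, e⟩; exact ⟨C, θ, h, hC, e⟩
  · rintro ⟨C, θ, h, hC, e⟩; exact ⟨θ, h, C, hC, e⟩

/-- The layer whose nodes form extended variables together with `x`. -/
def level (σ : AlgState V) (x : Var) : ℕ := ((σ.ℓ : ℕ∞) - σ.vExp x).toNat

theorem level_top {x : Var} (h : σ.vExp x = ⊤) : σ.level x = 0 := by simp [level, h]

theorem level_coe {x : Var} {v : ℕ} (h : σ.vExp x = v) : σ.level x = σ.ℓ - v := by
  rw [level, h, ← ENat.natCast_sub, ENat.toNat_natCast]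

theorem mem_varExt [Fintype Var] {x : Var} {η : Node Q Var} :
    (x, η) ∈ σ.varExt ↔ η ∈ σ.tree ∧ η.length = σ.level x := by
  simp only [varExt, Finset.mem_filter, Finset.mem_product, Finset.mem_univ, true_and]
  refine and_congr_right fun _ => ?_
  cases h : σ.vExp x using ENat.recTopCoe with
  | top => simp [level_top h]
  | coe v => rw [level_coe h, ← ENat.natCast_sub, Nat.cast_inj]

/-- The structural invariant of the algorithm. -/
structure WellFormed (σ : AlgState V) : Prop where
  one_le : 1 ≤ σ.ℓ
  length_lt : ∀ η ∈ σ.tree, η.length < σ.ℓ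
  of_cons : ∀ C η, C :: η ∈ σ.tree → η ∈ σ.tree ∧ C.IsSubVASS (label V η)
  connected : ∀ η ∈ σ.tree, (label V η).Connected
  eq_of_mem_states : ∀ η ∈ σ.tree, ∀ θ ∈ σ.tree, η.length = θ.length →
    ∀ q ∈ (label V η).states, q ∈ (label V θ).states → η = θ
  vExp_mem : ∀ (x : Var) (v : ℕ), σ.vExp x = v → 1 ≤ v ∧ v < σ.ℓ

namespace WellFormed

theorem drop (hσ : σ.WellFormed) {η : Node Q Var} (hη : η ∈ σ.tree) (m : ℕ) :
    η.drop m ∈ σ.tree ∧ (label V η).IsSubVASS (label V (η.drop m)) := by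
  induction m generalizing η with
  | zero => exact ⟨by simpa using hη, by simpa using VASS.IsSubVASS.refl _⟩
  | succ m ih =>
    cases η with
    | nil => exact ⟨by simpa using hη, by simpa using VASS.IsSubVASS.refl _⟩
    | cons C η =>
      obtain ⟨h, hs⟩ := hσ.of_cons C η hη
      exact ⟨(ih h).1, hs.trans (ih h).2⟩

/-- Labels shrink along a branch, so two equal labels force equality at every node between them. -/
theorem label_drop_eq (hσ : σ.WellFormed) {η : Node Q Var} (hη : η ∈ σ.tree) {m m' : ℕ}
    (h : m ≤ m') (he : label V (η.drop m') = label V η) : label V (η.drop m) = label V η := by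
  refine VASS.IsSubVASS.antisymm ?_ (hσ.drop hη m).2
  have := (hσ.drop (hσ.drop hη m).1 (m' - m)).2
  rwa [List.drop_drop, Nat.add_sub_cancel' h, he] at this

theorem isSubVASS (hσ : σ.WellFormed) {η : Node Q Var} (hη : η ∈ σ.tree) :
    (label V η).IsSubVASS V := by
  simpa using (hσ.drop hη η.length).2

theorem level_lt (hσ : σ.WellFormed) (x : Var) : σ.level x ≤ σ.ℓ - 1 := by
  cases h : σ.vExp x using ENat.recTopCoe with
  | top => simp [level_top h]
  | coe v => have := hσ.vExp_mem x v h; rw [level_coe h]; omega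

/-- Labels within one layer have disjoint state sets, so a transition determines the node of each
layer that contains it. -/
theorem eq_ancestor (hσ : σ.WellFormed) {η θ : Node Q Var} (hη : η ∈ σ.tree) (hθ : θ ∈ σ.tree)
    (hle : θ.length ≤ η.length) {t : Transition Q Var} (ht : t ∈ (label V η).transitions)
    (ht' : t ∈ (label V θ).transitions) : θ = ancestor η θ.length :=
  hσ.eq_of_mem_states θ hθ _ (hσ.drop hη _).1 (length_ancestor hle).symm t.1
    (VASS.src_mem _ t ht') ((hσ.drop hη _).2.1 (VASS.src_mem _ t ht))

end WellFormed

theorem WellFormed.init (hV : V.Connected) : (AlgState.init V).WellFormed where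
  one_le := le_rfl
  length_lt := by simp [AlgState.init]
  of_cons := by simp [AlgState.init]
  connected := by simpa [AlgState.init] using hV
  eq_of_mem_states := by simp [AlgState.init]
  vExp_mem := by simp [AlgState.init]

end AlgState

end

/-! ### Optimal solutions over the rationals, and one iteration as a `Step` -/

section

variable {Q Var : Type*}

/-- Used to make coefficients of arbitrary sign admissible: adding a multiple of a balancing vector
does not affect the drift. -/
theorem exists_nonneg_add_smul {ι : Type*} [Fintype ι] (f g : ι → ℚ)
    (h : ∀ i, 0 < g i ∨ (f i = 0 ∧ g i = 0)) : ∃ K : ℚ, ∀ i, 0 ≤ (f + K • g) i := by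
  refine ⟨∑ i, |f i| / |g i|, fun i => ?_⟩
  rw [Pi.add_apply, Pi.smul_apply, smul_eq_mul]
  rcases h i with hi | ⟨h₁, h₂⟩
  · have h₁ : |f i| / |g i| ≤ ∑ i, |f i| / |g i| :=
      Finset.single_le_sum (f := fun i => |f i| / |g i|) (fun i _ => by positivity)
        (Finset.mem_univ i)
    have h₂ : |f i| / |g i| * g i = |f i| := by
      rw [abs_of_pos hi, div_mul_cancel₀ _ hi.ne']
    have h₃ := mul_le_mul_of_nonneg_right h₁ hi.le
    have h₄ := neg_abs_le (f i)
    linarith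
  · rw [h₁, h₂]; simp

theorem exists_common_denominator {ι : Type*} [Finite ι] (q : ι → ℚ) :
    ∃ (D : ℕ) (n : ι → ℤ), 0 < D ∧ ∀ i, (n i : ℚ) = D * q i := by
  have := Fintype.ofFinite ι
  have hdvd : ∀ i, (q i).den ∣ ∏ j, (q j).den := fun i =>
    Finset.dvd_prod_of_mem _ (Finset.mem_univ i)
  choose c hc using hdvd
  refine ⟨∏ j, (q j).den, fun i => c i * (q i).num, Finset.prod_pos fun i _ => (q i).pos, ?_⟩
  intro i
  rw [hc i]
  push_cast
  nth_rw 3 [← Rat.num_div_den (q i)]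
  have : ((q i).den : ℚ) ≠ 0 := by exact_mod_cast (q i).den_nz
  field_simp

namespace AlgState

variable {V : VASS Q Var} {σ : AlgState V}

/-- The coefficients of the extended variables that are relevant for the node `η`. -/
def localize (σ : AlgState V) (ρ : Var → Node Q Var → ℚ) (η : Node Q Var) (x : Var) : ℚ :=
  ρ x (ancestor η (σ.level x))

theorem WellFormed.sum_states (hσ : σ.WellFormed) (ζ : Q → ℚ) (t : σ.U) :
    ∑ s : V.states, (σ.flowMatrix s t : ℚ) * ζ s = ζ t.1.2.2 - ζ t.1.1 := by
  classical
  obtain ⟨η, hη, ht⟩ := mem_U.1 t.2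
  have htV := (hσ.isSubVASS (mem_layer.1 hη).1).2 ht
  by_cases he : t.1.1 = t.1.2.2
  · simp [flowMatrix, he]
  · have h : ∀ s : V.states, (σ.flowMatrix s t : ℚ) * ζ s =
        (if s = ⟨t.1.2.2, V.tgt_mem _ htV⟩ then ζ s else 0) -
          (if s = ⟨t.1.1, V.src_mem _ htV⟩ then ζ s else 0) := by
      intro s
      simp only [flowMatrix, Matrix.of_apply, if_neg he, Subtype.ext_iff]
      by_cases h₁ : s.1 = t.1.1
      · have h₂ : ¬ s.1 = t.1.2.2 := fun h => he (h₁.symm.trans h)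
        rw [if_pos h₁, if_neg h₂, if_pos h₁]; push_cast; ring
      · rw [if_neg h₁, if_neg h₁]
        split_ifs <;> simp
    simp only [h, Finset.sum_sub_distrib, Finset.sum_ite_eq', Finset.mem_univ, if_true]

variable [Fintype Var]

theorem WellFormed.sum_varExt (hσ : σ.WellFormed) (ρ : Var → Node Q Var → ℚ) {η : Node Q Var}
    (hη : η ∈ σ.layer (σ.ℓ - 1)) (t : σ.U) (ht : t.1 ∈ (label V η).transitions) :
    ∑ p : σ.varExt, (σ.extUpdateMatrix p t : ℚ) * ρ p.1.1 p.1.2 =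
      ∑ x, σ.localize ρ η x * (t.1.2.1 x : ℚ) := by
  classical
  obtain ⟨hη, hlen⟩ := mem_layer.1 hη
  have hlev : ∀ x, σ.level x ≤ η.length := fun x => hlen ▸ hσ.level_lt x
  have hanc : ∀ x, (x, ancestor η (σ.level x)) ∈ σ.varExt := fun x =>
    mem_varExt.2 ⟨(hσ.drop hη _).1, length_ancestor (hlev x)⟩
  symm
  refine Finset.sum_of_injOn (fun x => ⟨(x, ancestor η (σ.level x)), hanc x⟩) ?_ ?_ ?_ ?_
  · intro x _ y _ h
    simp only [Subtype.mk.injEq, Prod.mk.injEq] at h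
    exact h.1
  · intro x _; simp
  -- Rows at nodes other than the ancestor of `η` vanish at `t`, because their labels do not contain
  -- `t`.
  · rintro ⟨⟨x, θ⟩, hp⟩ - hx
    rw [extUpdateMatrix, Matrix.of_apply, if_neg, Int.cast_zero, zero_mul]
    intro htθ
    obtain ⟨hθ, hθlen⟩ := mem_varExt.1 hp
    have := hσ.eq_ancestor hη hθ (hθlen ▸ hlev x) ht htθ
    refine hx ⟨x, Finset.mem_coe.2 (Finset.mem_univ x), ?_⟩
    simp only [Subtype.mk.injEq, Prod.mk.injEq, true_and]
    rw [this, hθlen]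
  · intro x _
    have hm : t.1 ∈ (label V (ancestor η (σ.level x))).transitions := (hσ.drop hη _).2.2 ht
    rw [extUpdateMatrix, Matrix.of_apply, if_pos hm, localize, mul_comm]

/-- In the label of a node of the last layer, the constraint system is about the drift with the
coefficients of the extended variables at the ancestors of the node. -/
theorem WellFormed.change_eq (hσ : σ.WellFormed) {r : σ.varExt → ℤ} {z : V.states → ℤ}
    {ρ : Var → Node Q Var → ℚ} {ζ : Q → ℚ} (hr : ∀ p, (r p : ℚ) = ρ p.1.1 p.1.2)
    (hz : ∀ s, (z s : ℚ) = ζ s) {η : Node Q Var} (hη : η ∈ σ.layer (σ.ℓ - 1)) (t : σ.U)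
    (ht : t.1 ∈ (label V η).transitions) :
    (σ.change r z t : ℚ) = drift (σ.localize ρ η) ζ t.1 := by
  rw [drift, ← hσ.sum_varExt ρ hη t ht, ← hσ.sum_states ζ t]
  simp only [change, Pi.add_apply, Matrix.mulVec, dotProduct, Matrix.transpose_apply, Int.cast_add,
    Int.cast_sum, Int.cast_mul, hr, hz]

theorem mem_decreasing {r : σ.varExt → ℤ} {z : V.states → ℤ} {t : Transition Q Var} :
    t ∈ σ.decreasing r z ↔ ∃ h : t ∈ σ.U, σ.change r z ⟨t, h⟩ < 0 := by
  simp [decreasing]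

theorem change_add (r r' : σ.varExt → ℤ) (z z' : V.states → ℤ) :
    σ.change (r + r') (z + z') = σ.change r z + σ.change r' z' := by
  simp only [change, Matrix.mulVec_add]; abel

/-- The strict inequalities of any solution are strict for every optimal solution. -/
theorem IsOptimal.strict {r r' : σ.varExt → ℤ} {z z' : V.states → ℤ} (h : σ.IsOptimal r z)
    (h' : σ.IsSolution r' z') :
    (∀ p, 0 < r' p → 0 < r p) ∧ ∀ t, σ.change r' z' t < 0 → σ.change r z t < 0 := by
  classical
  obtain ⟨⟨hr, hz, hc⟩, hopt⟩ := h
  obtain ⟨hr', hz', hc'⟩ := h'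
  -- Solutions form a cone, and a sum is strict wherever one summand is. Since the objective cannot
  -- grow, the strict inequalities of `r, z` already include those of the sum.
  have hsum : σ.IsSolution (r + r') (z + z') :=
    ⟨add_nonneg hr hr', add_nonneg hz hz', by rw [change_add]; exact add_nonpos hc hc'⟩
  have hle := hopt _ _ hsum
  have h₁ : (Finset.univ.filter fun p => 0 < r p) ⊆
      Finset.univ.filter fun p => 0 < (r + r') p := by
    intro p hp
    simp only [Finset.mem_filter, Finset.mem_univ, true_and, Pi.add_apply] at hp ⊢
    exact add_pos_of_pos_of_nonneg hp (hr' p)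
  have h₂ : (Finset.univ.filter fun t => σ.change r z t < 0) ⊆
      Finset.univ.filter fun t => σ.change (r + r') (z + z') t < 0 := by
    intro t ht
    simp only [Finset.mem_filter, Finset.mem_univ, true_and, change_add, Pi.add_apply] at ht ⊢
    exact add_neg_of_neg_of_nonpos ht (hc' t)
  have hc₁ := Finset.card_le_card h₁
  have hc₂ := Finset.card_le_card h₂
  simp only [objective] at hle
  have e₁ := Finset.eq_of_subset_of_card_le h₁ (by omega)
  have e₂ := Finset.eq_of_subset_of_card_le h₂ (by omega)
  constructor
  · intro p hp
    have : p ∈ Finset.univ.filter fun p => 0 < (r + r') p := by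
      simp only [Finset.mem_filter, Finset.mem_univ, true_and, Pi.add_apply]
      exact add_pos_of_nonneg_of_pos (hr p) hp
    rw [← e₁] at this
    simpa using this
  · intro t ht
    have : t ∈ Finset.univ.filter fun t => σ.change (r + r') (z + z') t < 0 := by
      simp only [Finset.mem_filter, Finset.mem_univ, true_and, change_add, Pi.add_apply]
      exact add_neg_of_nonpos_of_neg (hc t) ht
    rw [← e₂] at this
    simpa using this

/-- `ρ, ζ` is a rational solution of the constraint system of the current iteration, with
coefficients for all states and all pairs of a variable and a node. -/
structure IsRatSolution (σ : AlgState V) (ρ : Var → Node Q Var → ℚ) (ζ : Q → ℚ) : Prop where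
  coeff_nonneg : ∀ x η, 0 ≤ ρ x η
  state_nonneg : ∀ q, 0 ≤ ζ q
  drift_nonpos : ∀ η ∈ σ.layer (σ.ℓ - 1), ∀ t ∈ (label V η).transitions,
    drift (σ.localize ρ η) ζ t ≤ 0

/-- Clearing denominators turns a rational solution into an integral one with the same strict
inequalities. -/
theorem IsOptimal.ratStrict (hσ : σ.WellFormed) {r : σ.varExt → ℤ} {z : V.states → ℤ}
    (h : σ.IsOptimal r z) {ρ : Var → Node Q Var → ℚ} {ζ : Q → ℚ} (h' : σ.IsRatSolution ρ ζ) :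
    (∀ p : σ.varExt, 0 < ρ p.1.1 p.1.2 → 0 < r p) ∧
      ∀ η ∈ σ.layer (σ.ℓ - 1), ∀ t ∈ (label V η).transitions,
        drift (σ.localize ρ η) ζ t < 0 → t ∈ σ.decreasing r z := by
  obtain ⟨D, n, hD, hn⟩ := exists_common_denominator
    (Sum.elim (fun p : σ.varExt => ρ p.1.1 p.1.2) (fun s : V.states => ζ s))
  have hD' : (0 : ℚ) < D := by exact_mod_cast hD
  have hch : ∀ η ∈ σ.layer (σ.ℓ - 1), ∀ t : σ.U, t.1 ∈ (label V η).transitions →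
      (σ.change (fun p => n (.inl p)) (fun s => n (.inr s)) t : ℚ) =
        D * drift (σ.localize ρ η) ζ t.1 := by
    intro η hη t ht
    rw [hσ.change_eq (ρ := fun x η => D * ρ x η) (ζ := (D : ℚ) • ζ) (fun p => hn (.inl p))
      (fun s => hn (.inr s)) hη t ht, ← drift_smul]
    rfl
  have hsol : σ.IsSolution (fun p => n (.inl p)) (fun s => n (.inr s)) := by
    refine ⟨fun p => ?_, fun s => ?_, fun t => ?_⟩
    · have : (0 : ℚ) ≤ n (.inl p) := by
        rw [hn]; exact mul_nonneg hD'.le (h'.coeff_nonneg _ _)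
      exact_mod_cast this
    · have : (0 : ℚ) ≤ n (.inr s) := by
        rw [hn]; exact mul_nonneg hD'.le (h'.state_nonneg _)
      exact_mod_cast this
    · obtain ⟨η, hη, ht⟩ := mem_U.1 t.2
      have := hch η hη t ht
      have h0 := mul_nonpos_of_nonneg_of_nonpos hD'.le (h'.drift_nonpos η hη t ht)
      rw [← this] at h0
      exact_mod_cast h0
  obtain ⟨h₁, h₂⟩ := h.strict hsol
  refine ⟨fun p hp => h₁ p ?_, fun η hη t ht hlt => ?_⟩
  · have : (0 : ℚ) < n (.inl p) := by rw [hn]; exact mul_pos hD' hp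
    exact_mod_cast this
  · have htU := mem_U.2 ⟨η, hη, ht⟩
    refine mem_decreasing.2 ⟨htU, h₂ _ ?_⟩
    have := hch η hη ⟨t, htU⟩ ht
    have h0 := mul_neg_of_pos_of_neg hD' hlt
    rw [← this] at h0
    exact_mod_cast h0

/-- `σ'` results from `σ` by one iteration of the loop, with the optimal solution `ρ, ζ` and the
set `R` of decreasing transitions. -/
structure Step (σ σ' : AlgState V) (R : Finset (Transition Q Var)) (ρ : Var → Node Q Var → ℚ)
    (ζ : Q → ℚ) : Prop where
  ℓ_eq : σ'.ℓ = σ.ℓ + 1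
  mem_tree : ∀ η, η ∈ σ'.tree ↔ η ∈ σ.tree ∨ ∃ C θ, θ ∈ σ.layer (σ.ℓ - 1) ∧
    C.IsSCC ((label V θ).removeTransitions R) ∧ C :: θ = η
  vExp_new : ∀ x, σ.vExp x = ⊤ → 0 < ρ x [] → σ'.vExp x = σ.ℓ
  vExp_old : ∀ x, ¬ (σ.vExp x = ⊤ ∧ 0 < ρ x []) → σ'.vExp x = σ.vExp x
  tExp_new : ∀ t : V.transitions, t.1 ∈ R → σ'.tExp t = σ.ℓ
  tExp_old : ∀ t : V.transitions, t.1 ∉ R → σ'.tExp t = σ.tExp t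
  mem_U : ∀ t ∈ R, t ∈ σ.U
  isRatSolution : σ.IsRatSolution ρ ζ
  drift_neg : ∀ η ∈ σ.layer (σ.ℓ - 1), ∀ t ∈ (label V η).transitions, t ∈ R →
    drift (σ.localize ρ η) ζ t < 0
  drift_eq_zero : ∀ η ∈ σ.layer (σ.ℓ - 1), ∀ t ∈ (label V η).transitions, t ∉ R →
    drift (σ.localize ρ η) ζ t = 0
  coeff_pos : ∀ ρ' ζ', σ.IsRatSolution ρ' ζ' → ∀ x, ∀ η ∈ σ.tree, η.length = σ.level x →
    0 < ρ' x η → 0 < ρ x η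
  mem_of_drift_neg : ∀ ρ' ζ', σ.IsRatSolution ρ' ζ' → ∀ η ∈ σ.layer (σ.ℓ - 1),
    ∀ t ∈ (label V η).transitions, drift (σ.localize ρ' η) ζ' t < 0 → t ∈ R

theorem exists_step (hσ : σ.WellFormed) {r : σ.varExt → ℤ} {z : V.states → ℤ}
    (h : σ.IsOptimal r z) : ∃ ρ ζ, σ.Step (σ.body r z).incr (σ.decreasing r z) ρ ζ := by
  classical
  let ρ : Var → Node Q Var → ℚ := fun x η =>
    if hp : (x, η) ∈ σ.varExt then (r ⟨(x, η), hp⟩ : ℚ) else 0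
  let ζ : Q → ℚ := fun q => if hq : q ∈ V.states then (z ⟨q, hq⟩ : ℚ) else 0
  have hρ : ∀ p : σ.varExt, (r p : ℚ) = ρ p.1.1 p.1.2 := fun p => by
    simp only [ρ]; rw [dif_pos p.2]
  have hζ : ∀ s : V.states, (z s : ℚ) = ζ s := fun s => by
    simp only [ζ]; rw [dif_pos s.2]
  have hch : ∀ η (hη : η ∈ σ.layer (σ.ℓ - 1)), ∀ t (ht : t ∈ (label V η).transitions),
      (σ.change r z ⟨t, AlgState.mem_U.2 ⟨η, hη, ht⟩⟩ : ℚ) = drift (σ.localize ρ η) ζ t :=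
    fun η hη t ht => hσ.change_eq hρ hζ hη ⟨t, _⟩ ht
  have hnonpos : ∀ η ∈ σ.layer (σ.ℓ - 1), ∀ t ∈ (label V η).transitions,
      drift (σ.localize ρ η) ζ t ≤ 0 := by
    intro η hη t ht
    rw [← hch η hη t ht]
    exact_mod_cast h.1.2.2 _
  have hR : ∀ η ∈ σ.layer (σ.ℓ - 1), ∀ t ∈ (label V η).transitions,
      (t ∈ σ.decreasing r z ↔ drift (σ.localize ρ η) ζ t < 0) := by
    intro η hη t ht
    rw [← hch η hη t ht, mem_decreasing]
    exact ⟨fun ⟨_, h⟩ => by exact_mod_cast h, fun h => ⟨_, by exact_mod_cast h⟩⟩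
  have hpos : ∀ x η, 0 < ρ x η ↔ ∃ hp : (x, η) ∈ σ.varExt, 0 < r ⟨(x, η), hp⟩ := by
    intro x η
    simp only [ρ]
    by_cases hp : (x, η) ∈ σ.varExt
    · rw [dif_pos hp]
      exact ⟨fun h => ⟨hp, by exact_mod_cast h⟩, fun ⟨_, h⟩ => by exact_mod_cast h⟩
    · rw [dif_neg hp]
      exact ⟨fun h => absurd h (lt_irrefl _), fun ⟨h, _⟩ => absurd h hp⟩
  refine ⟨ρ, ζ, ?_⟩
  constructor
  case ℓ_eq => rfl
  case mem_tree =>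
    intro η
    simp only [body, incr, Finset.mem_union, mem_newNodes]
  case vExp_new => exact fun x hx h0 => if_pos ⟨hx, (hpos x []).1 h0⟩
  case vExp_old => exact fun x hx => if_neg fun h => hx ⟨h.1, (hpos x []).2 h.2⟩
  case tExp_new => exact fun t ht => if_pos ht
  case tExp_old => exact fun t ht => if_neg ht
  case mem_U => exact fun t ht => (mem_decreasing.1 ht).1
  case isRatSolution =>
    refine ⟨fun x η => ?_, fun q => ?_, hnonpos⟩
    · simp only [ρ]
      split_ifs with hp
      · exact_mod_cast h.1.1 _
      · exact le_rfl
    · simp only [ζ]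
      split_ifs with hq
      · exact_mod_cast h.1.2.1 _
      · exact le_rfl
  case drift_neg => exact fun η hη t ht => (hR η hη t ht).1
  case drift_eq_zero =>
    exact fun η hη t ht htR =>
      (hnonpos η hη t ht).eq_of_not_lt fun hlt => htR ((hR η hη t ht).2 hlt)
  case coeff_pos =>
    intro ρ' ζ' h' x η hη hlen h0
    exact (hpos x η).2 ⟨mem_varExt.2 ⟨hη, hlen⟩,
      (h.ratStrict hσ h').1 ⟨(x, η), mem_varExt.2 ⟨hη, hlen⟩⟩ h0⟩
  case mem_of_drift_neg => exact fun ρ' ζ' h' => (h.ratStrict hσ h').2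

end AlgState

end

/-! ### Linear algebra of balancing coefficients -/

section

variable {Q Var : Type*}

open Classical in
/-- Replace the coordinates in `B` by zero. -/
def eraseCoords (B : Finset Var) : (Var → ℚ) →ₗ[ℚ] (Var → ℚ) where
  toFun f x := if x ∈ B then 0 else f x
  map_add' f g := by ext x; by_cases h : x ∈ B <;> simp [h]
  map_smul' c f := by ext x; by_cases h : x ∈ B <;> simp [h]

theorem eraseCoords_of_mem {B : Finset Var} {x : Var} (h : x ∈ B) (f : Var → ℚ) :
    eraseCoords B f x = 0 := by simp [eraseCoords, h]

theorem eraseCoords_of_notMem {B : Finset Var} {x : Var} (h : x ∉ B) (f : Var → ℚ) :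
    eraseCoords B f x = f x := by simp [eraseCoords, h]

variable [Fintype Var]

/-- The coefficients with support in `A` that, with suitable potentials for the states, yield a
ranking function that no transition of `S` changes. -/
def balancing (S : VASS Q Var) (A : Finset Var) : Submodule ℚ (Var → ℚ) where
  carrier := {f | (∀ x ∉ A, f x = 0) ∧ ∃ ζ : Q → ℚ, ∀ t ∈ S.transitions, drift f ζ t = 0}
  add_mem' := by
    rintro f g ⟨hf, ζ, hζ⟩ ⟨hg, ξ, hξ⟩
    refine ⟨fun x hx => by simp [hf x hx, hg x hx], ζ + ξ, fun t ht => ?_⟩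
    rw [drift_add, hζ t ht, hξ t ht, add_zero]
  zero_mem' := ⟨fun _ _ => rfl, 0, fun t _ => by simp [drift_zero]⟩
  smul_mem' := by
    rintro c f ⟨hf, ζ, hζ⟩
    refine ⟨fun x hx => by simp [hf x hx], c • ζ, fun t ht => ?_⟩
    rw [drift_smul, hζ t ht, mul_zero]

/-- The coefficients outside of `B` of the elements of `balancing S A`. -/
def balancingOff (S : VASS Q Var) (A B : Finset Var) : Submodule ℚ (Var → ℚ) :=
  (balancing S A).map (eraseCoords B)

/-- Ranking functions with coefficients in `B` that do not increase along the transitions of `S` are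
constant along them. -/
def Saturated (S : VASS Q Var) (B : Finset Var) : Prop :=
  ∀ (f : Var → ℚ) (ζ : Q → ℚ), (∀ x ∉ B, f x = 0) → (∀ t ∈ S.transitions, drift f ζ t ≤ 0) →
    ∀ t ∈ S.transitions, drift f ζ t = 0

open Classical in
/-- The codimension of `balancingOff S A B` in the space of the coefficients in `A \ B`. -/
def excess (S : VASS Q Var) (A B : Finset Var) : ℕ :=
  (A \ B).card - Module.finrank ℚ (balancingOff S A B)

variable {S S' : VASS Q Var} {A A' B : Finset Var}

theorem balancing_le (h : S'.IsSubVASS S) : balancing S A ≤ balancing S' A :=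
  fun _ ⟨hf, ζ, hζ⟩ => ⟨hf, ζ, fun t ht => hζ t (h.2 ht)⟩

theorem balancing_mono (h : A ⊆ A') : balancing S A ≤ balancing S A' :=
  fun _ ⟨hf, ζ, hζ⟩ => ⟨fun x hx => hf x fun hx' => hx (h hx'), ζ, hζ⟩

open Classical in
theorem finrank_le_card_of_support (W : Submodule ℚ (Var → ℚ)) (s : Finset Var)
    (h : ∀ f ∈ W, ∀ x ∉ s, f x = 0) : Module.finrank ℚ W ≤ s.card := by
  let φ : W →ₗ[ℚ] (s → ℚ) := (LinearMap.funLeft ℚ ℚ (Subtype.val : s → Var)).comp W.subtype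
  have hφ : Function.Injective φ := by
    intro f g hfg
    ext x
    by_cases hx : x ∈ s
    · exact congrFun hfg ⟨x, hx⟩
    · rw [h f f.2 x hx, h g g.2 x hx]
  simpa using LinearMap.finrank_le_finrank_of_injective hφ

-- Hence the truncated subtraction in `excess` is a true codimension.
open Classical in
theorem finrank_balancingOff_le : Module.finrank ℚ (balancingOff S A B) ≤ (A \ B).card := by
  refine finrank_le_card_of_support _ _ ?_
  rintro _ ⟨f, hf, rfl⟩ x hx
  by_cases hB : x ∈ B
  · exact eraseCoords_of_mem hB f
  · rw [eraseCoords_of_notMem hB]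
    exact hf.1 x fun hA => hx (Finset.mem_sdiff.2 ⟨hA, hB⟩)

theorem excess_le_of_isSubVASS (h : S'.IsSubVASS S) : excess S' A B ≤ excess S A B :=
  Nat.sub_le_sub_left (Submodule.finrank_mono (Submodule.map_mono (balancing_le h))) _

/-- The vector `f` balances `S'`. If its coordinates off `B` also came from some `n` balancing `S`,
then `f - n` would live on `B` and have the drift of `f` on `S`, nonpositive and somewhere negative,
against saturation. So the space gains a dimension. -/
theorem excess_lt_of_saturated (h : S'.IsSubVASS S) (hB : Saturated S B) {f : Var → ℚ} {ζ : Q → ℚ}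
    (hf : ∀ x ∉ A, f x = 0) (hle : ∀ t ∈ S.transitions, drift f ζ t ≤ 0)
    (hlt : ∃ t ∈ S.transitions, drift f ζ t < 0) (hzero : ∀ t ∈ S'.transitions, drift f ζ t = 0) :
    excess S' A B < excess S A B := by
  have hmono : balancingOff S A B ≤ balancingOff S' A B := Submodule.map_mono (balancing_le h)
  have hne : balancingOff S A B ≠ balancingOff S' A B := by
    intro heq
    have hmem : eraseCoords B f ∈ balancingOff S A B := by
      rw [heq]; exact ⟨f, ⟨hf, ζ, hzero⟩, rfl⟩
    obtain ⟨n, ⟨-, ξ, hξ⟩, hn⟩ := hmem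
    obtain ⟨t, ht, htlt⟩ := hlt
    have hd : ∀ t ∈ S.transitions, drift (f - n) (ζ - ξ) t = drift f ζ t := fun t ht => by
      rw [drift_sub, hξ t ht, sub_zero]
    have := hB (f - n) (ζ - ξ) (fun x hx => ?_) (fun t ht => (hd t ht).trans_le (hle t ht)) t ht
    · rw [hd t ht] at this; exact htlt.ne this
    · have := congrFun hn x
      rw [eraseCoords_of_notMem hx, eraseCoords_of_notMem hx] at this
      simp [this]
  have hlt' := Submodule.finrank_lt_finrank_of_lt (lt_of_le_of_ne hmono hne)
  have := finrank_balancingOff_le (S := S') (A := A) (B := B)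
  simp only [excess]
  omega

-- Enlarging `A` adds `(A' \ A).card` coordinates, but `g` is a balancing vector that does not come
-- from `A`, so the balancing space gains at least one dimension too.
open Classical in
theorem excess_le_add (hA : A ⊆ A') (hB : B ⊆ A) {g : Var → ℚ} (hg : g ∈ balancing S A') {x : Var}
    (hx : x ∈ A') (hxA : x ∉ A) (hgx : g x ≠ 0) :
    excess S A' B ≤ excess S A B + ((A' \ A).card - 1) := by
  have hlt : balancingOff S A B < balancingOff S A' B := by
    refine lt_of_le_of_ne (Submodule.map_mono (balancing_mono hA)) fun heq => ?_
    have hmem : eraseCoords B g ∈ balancingOff S A B := by rw [heq]; exact ⟨g, hg, rfl⟩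
    obtain ⟨f, ⟨hf, -⟩, hfg⟩ := hmem
    have := congrFun hfg x
    rw [eraseCoords_of_notMem (fun h => hxA (hB h)), eraseCoords_of_notMem (fun h => hxA (hB h)),
      hf x hxA] at this
    exact hgx this.symm
  have hlt' := Submodule.finrank_lt_finrank_of_lt hlt
  have hcard : (A' \ B).card = (A \ B).card + (A' \ A).card := by
    rw [Finset.card_sdiff_of_subset hA, Finset.card_sdiff_of_subset hB,
      Finset.card_sdiff_of_subset (hB.trans hA)]
    have := Finset.card_le_card hA
    have := Finset.card_le_card hB
    omega
  have hpos : 0 < (A' \ A).card := Finset.card_pos.2 ⟨x, Finset.mem_sdiff.2 ⟨hx, hxA⟩⟩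
  simp only [excess]
  omega

theorem excess_self : excess S A A = 0 := by
  classical
  rw [excess, Finset.sdiff_self, Finset.card_empty, Nat.zero_sub]

theorem saturated_empty (hS : S.Connected) : Saturated S (∅ : Finset Var) := by
  intro f ζ hf hle t ht
  obtain rfl : f = 0 := funext fun x => hf x (Finset.notMem_empty x)
  simp only [drift_zero] at hle ⊢
  exact sub_eq_zero.2 (hS.potential_eq (fun t ht => sub_nonpos.1 (hle t ht)) ht)

end

/-! ### Positive solutions, balance and saturation along the iterations -/

section

namespace AlgState

variable {Q Var : Type*} [Fintype Var] {V : VASS Q Var} {σ σ' : AlgState V}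
  {R : Finset (Transition Q Var)} {ρ : Var → Node Q Var → ℚ} {ζ : Q → ℚ}

open Classical in
/-- The variables whose exponent is at most `m`. -/
def known (σ : AlgState V) (m : ℕ) : Finset Var :=
  Finset.univ.filter fun x => σ.vExp x ≤ m

theorem mem_known {m : ℕ} {x : Var} : x ∈ σ.known m ↔ σ.vExp x ≤ m := by simp [known]

theorem known_mono {m m' : ℕ} (h : m ≤ m') : σ.known m ⊆ σ.known m' := fun _ hx =>
  mem_known.2 ((mem_known.1 hx).trans (by exact_mod_cast h))

/-- A solution that is positive for all variables with a known exponent. -/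
def HasPositiveSolution (σ : AlgState V) : Prop :=
  ∃ ρ ζ, σ.IsRatSolution ρ ζ ∧
    ∀ x, σ.vExp x ≠ ⊤ → ∀ η ∈ σ.tree, η.length = σ.level x → 0 < ρ x η

/-- The labels of the last layer have balancing coefficients that are positive exactly for
the variables with an exponent up to any given bound. -/
def IsBalanced (σ : AlgState V) : Prop :=
  ∀ η ∈ σ.layer (σ.ℓ - 1), ∀ m, ∃ g ∈ balancing (label V η) (σ.known m), ∀ x ∈ σ.known m, 0 < g x

/-- A node of the last layer whose label has not changed for `m` layers is saturated for the
variables with an exponent up to `m`. -/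
def IsSaturated (σ : AlgState V) : Prop :=
  ∀ η ∈ σ.layer (σ.ℓ - 1), ∀ m ≤ η.length, label V (η.drop m) = label V η →
    Saturated (label V η) (σ.known m)

namespace Step

theorem mem_layer_last (h : σ.Step σ' R ρ ζ) (hσ : σ.WellFormed) {η : Node Q Var} :
    η ∈ σ'.layer (σ'.ℓ - 1) ↔ ∃ C θ, θ ∈ σ.layer (σ.ℓ - 1) ∧
      C.IsSCC ((label V θ).removeTransitions R) ∧ C :: θ = η := by
  rw [mem_layer, h.mem_tree, h.ℓ_eq, Nat.add_sub_cancel]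
  have := hσ.one_le
  constructor
  · rintro ⟨hη | hη, hlen⟩
    · exact absurd hlen (hσ.length_lt η hη).ne
    · exact hη
  · rintro ⟨C, θ, hθ, hC, rfl⟩
    refine ⟨.inr ⟨C, θ, hθ, hC, rfl⟩, ?_⟩
    rw [List.length_cons, (mem_layer.1 hθ).2]; omega

theorem vExp_cases (h : σ.Step σ' R ρ ζ) (x : Var) :
    (σ'.vExp x = σ.vExp x ∧ ¬ (σ.vExp x = ⊤ ∧ 0 < ρ x [])) ∨
      (σ.vExp x = ⊤ ∧ 0 < ρ x [] ∧ σ'.vExp x = σ.ℓ) := by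
  by_cases hx : σ.vExp x = ⊤ ∧ 0 < ρ x []
  · exact .inr ⟨hx.1, hx.2, h.vExp_new x hx.1 hx.2⟩
  · exact .inl ⟨h.vExp_old x hx, hx⟩

theorem vExp_eq_top (h : σ.Step σ' R ρ ζ) {x : Var} (hx : σ'.vExp x = ⊤) :
    σ.vExp x = ⊤ ∧ ¬ 0 < ρ x [] := by
  rcases h.vExp_cases x with ⟨he, hn⟩ | ⟨-, -, he⟩
  · rw [hx] at he
    exact ⟨he.symm, fun h0 => hn ⟨he.symm, h0⟩⟩
  · rw [hx] at he
    exact absurd he.symm (ENat.natCast_ne_top _)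

theorem level_eq (h : σ.Step σ' R ρ ζ) {x : Var} {v : ℕ} (hx : σ'.vExp x = v) :
    σ.level x = σ.ℓ - v := by
  rcases h.vExp_cases x with ⟨he, -⟩ | ⟨ht, -, he⟩
  · exact level_coe (he.symm.trans hx)
  · have : σ.ℓ = v := by exact_mod_cast he.symm.trans hx
    rw [level_top ht, this, Nat.sub_self]

theorem wellFormed (h : σ.Step σ' R ρ ζ) (hσ : σ.WellFormed) : σ'.WellFormed where
  one_le := by have := h.ℓ_eq; omega
  length_lt η hη := by
    rw [h.ℓ_eq]
    rcases (h.mem_tree η).1 hη with hη | ⟨C, θ, hθ, -, rfl⟩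
    · exact (hσ.length_lt η hη).trans (Nat.lt_succ_self _)
    · rw [List.length_cons]
      exact Nat.succ_lt_succ (hσ.length_lt θ (mem_layer.1 hθ).1)
  of_cons C η hη := by
    rcases (h.mem_tree _).1 hη with hη | ⟨C', θ, hθ, hC, he⟩
    · obtain ⟨h₁, h₂⟩ := hσ.of_cons C η hη
      exact ⟨(h.mem_tree _).2 (.inl h₁), h₂⟩
    · obtain ⟨rfl, rfl⟩ := List.cons.inj he
      exact ⟨(h.mem_tree _).2 (.inl (mem_layer.1 hθ).1),
        hC.1.trans (VASS.removeTransitions_isSubVASS _ _)⟩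
  connected η hη := by
    rcases (h.mem_tree η).1 hη with hη | ⟨C, θ, hθ, hC, rfl⟩
    · exact hσ.connected η hη
    · exact hC.2.1
  eq_of_mem_states η hη θ hθ hlen q hq hq' := by
    have hlast : ∀ {C : VASS Q Var} {θ η : Node Q Var}, θ ∈ σ.layer (σ.ℓ - 1) → η ∈ σ.tree →
        η.length ≠ (C :: θ).length := by
      intro C θ η hθ hη he
      have h₁ := hσ.one_le
      have h₂ := hσ.length_lt η hη
      rw [he, List.length_cons, (mem_layer.1 hθ).2] at h₂
      omega
    rcases (h.mem_tree η).1 hη with hη₁ | ⟨C, η, hη₁, hC, rfl⟩ <;>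
      rcases (h.mem_tree θ).1 hθ with hθ₁ | ⟨D, θ, hθ₁, hD, rfl⟩
    · exact hσ.eq_of_mem_states η hη₁ θ hθ₁ hlen q hq hq'
    · exact absurd hlen (hlast hθ₁ hη₁)
    · exact absurd hlen.symm (hlast hη₁ hθ₁)
    · rw [label_cons] at hq hq'
      have := hσ.eq_of_mem_states η (mem_layer.1 hη₁).1 θ (mem_layer.1 hθ₁).1
        ((mem_layer.1 hη₁).2.trans (mem_layer.1 hθ₁).2.symm) q (hC.1.1 hq) (hD.1.1 hq')
      subst this
      rw [hC.eq_of_mem_states hD hq hq']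
  vExp_mem x v hv := by
    rw [h.ℓ_eq]
    rcases h.vExp_cases x with ⟨he, -⟩ | ⟨-, -, he⟩
    · have := hσ.vExp_mem x v (he.symm.trans hv); omega
    · have : σ.ℓ = v := by exact_mod_cast he.symm.trans hv
      have := hσ.one_le; omega

/-- For previously known variables, optimality inherits positivity from the given solution; newly
found ones are positive at the root by definition. -/
theorem coeff_pos_of_known (h : σ.Step σ' R ρ ζ) (hpos : σ.HasPositiveSolution) {x : Var}
    (hx : σ'.vExp x ≠ ⊤) {η : Node Q Var} (hη : η ∈ σ.tree) (hlen : η.length = σ.level x) :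
    0 < ρ x η := by
  obtain ⟨ρ', ζ', hsol, hρ'⟩ := hpos
  rcases h.vExp_cases x with ⟨he, -⟩ | ⟨ht, h0, -⟩
  · exact h.coeff_pos ρ' ζ' hsol x η hη hlen (hρ' x (he ▸ hx) η hη hlen)
  · rw [level_top ht, List.length_eq_zero_iff] at hlen
    rwa [hlen]

theorem localize_pos (h : σ.Step σ' R ρ ζ) (hσ : σ.WellFormed) (hpos : σ.HasPositiveSolution)
    {x : Var} (hx : σ'.vExp x ≠ ⊤) {η : Node Q Var} (hη : η ∈ σ.layer (σ.ℓ - 1)) :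
    0 < σ.localize ρ η x := by
  obtain ⟨hη, hlen⟩ := mem_layer.1 hη
  exact h.coeff_pos_of_known hpos hx (hσ.drop hη _).1 (length_ancestor (hlen ▸ hσ.level_lt x))

theorem localize_eq_zero (h : σ.Step σ' R ρ ζ) {x : Var} (hx : σ'.vExp x = ⊤) (η : Node Q Var) :
    σ.localize ρ η x = 0 := by
  obtain ⟨ht, h0⟩ := h.vExp_eq_top hx
  have : ancestor η (σ.level x) = [] := by simp [ancestor, level_top ht]
  rw [localize, this]
  exact le_antisymm (not_lt.1 h0) (h.isRatSolution.coeff_nonneg x [])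

-- The level of a known variable moves down with `ℓ`, so giving each node the coefficient of its
-- parent reproduces the previous local ranking functions. Unknown variables stay at the root.
open Classical in
theorem hasPositiveSolution (h : σ.Step σ' R ρ ζ) (hσ : σ.WellFormed)
    (hpos : σ.HasPositiveSolution) : σ'.HasPositiveSolution := by
  refine ⟨fun x η => if σ'.vExp x = ⊤ then ρ x η else ρ x η.tail, ζ,
    ⟨fun x η => ?_, h.isRatSolution.state_nonneg, fun η hη t ht => ?_⟩, ?_⟩
  · split_ifs <;> exact h.isRatSolution.coeff_nonneg _ _
  · obtain ⟨C, θ, hθ, hC, rfl⟩ := (h.mem_layer_last hσ).1 hη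
    have hlev : ∀ x, σ.level x ≤ θ.length := fun x => (mem_layer.1 hθ).2 ▸ hσ.level_lt x
    have hloc : σ'.localize (fun x η => if σ'.vExp x = ⊤ then ρ x η else ρ x η.tail) (C :: θ) =
        σ.localize ρ θ := by
      funext x
      simp only [localize]
      split_ifs with hx
      · rw [level_top hx, level_top (h.vExp_eq_top hx).1, ancestor_cons (Nat.zero_le _)]
      · obtain ⟨v, hv⟩ := ENat.ne_top_iff_exists.1 hx
        have h₁ := h.level_eq hv.symm
        have h₂ := level_coe hv.symm
        have h₃ := (h.wellFormed hσ).vExp_mem x v hv.symm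
        have h₄ := h.ℓ_eq
        have : σ'.level x = σ.level x + 1 := by omega
        rw [this, tail_ancestor_cons (hlev x)]
    rw [hloc]
    exact h.isRatSolution.drift_nonpos θ hθ t
      (VASS.mem_removeTransitions.1 (hC.1.2 ht)).1
  · intro x hx η hη hlen
    simp only [if_neg hx]
    obtain ⟨v, hv⟩ := ENat.ne_top_iff_exists.1 hx
    have h₁ := h.level_eq hv.symm
    have h₂ := level_coe hv.symm
    have h₃ := (h.wellFormed hσ).vExp_mem x v hv.symm
    have h₄ := h.ℓ_eq
    cases η with
    | nil => rw [List.length_nil] at hlen; omega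
    | cons C η =>
      rw [List.length_cons] at hlen
      refine h.coeff_pos_of_known hpos hx ?_ (by rw [List.tail_cons]; omega)
      rcases (h.mem_tree _).1 hη with hη | ⟨C', θ, hθ, -, he⟩
      · exact (hσ.of_cons C η hη).1
      · obtain ⟨rfl, rfl⟩ := List.cons.inj he
        exact (mem_layer.1 hθ).1

theorem known_eq (h : σ.Step σ' R ρ ζ) {m : ℕ} (hm : m < σ.ℓ) : σ'.known m = σ.known m := by
  ext x
  rw [mem_known, mem_known]
  rcases h.vExp_cases x with ⟨he, -⟩ | ⟨ht, -, he⟩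
  · rw [he]
  · rw [he, ht]
    simp [hm]

theorem isBalanced (h : σ.Step σ' R ρ ζ) (hσ : σ.WellFormed) (hpos : σ.HasPositiveSolution)
    (hbal : σ.IsBalanced) : σ'.IsBalanced := by
  intro η hη m
  obtain ⟨C, θ, hθ, hC, rfl⟩ := (h.mem_layer_last hσ).1 hη
  rw [label_cons]
  have hCθ := hC.1.trans (VASS.removeTransitions_isSubVASS _ _)
  -- Below `σ.ℓ` the set `known m` is final and the old vector still balances the smaller label.
  -- From `σ.ℓ` on it contains all known variables, and the local part of the current solution is a
  -- witness: its drift is zero on all surviving transitions.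
  by_cases hm : m < σ.ℓ
  · obtain ⟨g, hg, hg0⟩ := hbal θ hθ m
    rw [h.known_eq hm]
    exact ⟨g, balancing_le hCθ hg, hg0⟩
  · have hknown : ∀ x, x ∈ σ'.known m ↔ σ'.vExp x ≠ ⊤ := by
      intro x
      rw [mem_known]
      refine ⟨fun hx ht => ?_, fun hx => ?_⟩
      · rw [ht, top_le_iff] at hx
        exact ENat.natCast_ne_top _ hx
      · obtain ⟨v, hv⟩ := ENat.ne_top_iff_exists.1 hx
        have h₃ := (h.wellFormed hσ).vExp_mem x v hv.symm
        have h₄ := h.ℓ_eq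
        rw [← hv]
        exact_mod_cast (by omega : v ≤ m)
    refine ⟨σ.localize ρ θ, ⟨fun x hx => ?_, ζ, fun t ht => ?_⟩, fun x hx => ?_⟩
    · exact h.localize_eq_zero (not_not.1 fun hne => hx ((hknown x).2 hne)) θ
    · obtain ⟨ht, htR⟩ := VASS.mem_removeTransitions.1 (hC.1.2 ht)
      exact h.drift_eq_zero θ hθ t ht htR
    · exact h.localize_pos hσ hpos ((hknown x).1 hx) hθ

open Classical in
theorem isSaturated (h : σ.Step σ' R ρ ζ) (hσ : σ.WellFormed) (hbal : σ'.IsBalanced) :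
    σ'.IsSaturated := by
  intro η' hη' m hm heq
  have hσ' := h.wellFormed hσ
  obtain ⟨g, ⟨hg, ξ, hξ⟩, hg0⟩ := hbal η' hη' m
  obtain ⟨C, θ, hθ, hC, rfl⟩ := (h.mem_layer_last hσ).1 hη'
  have hη'' := (mem_layer.1 hη').1
  obtain ⟨hθt, hθlen⟩ := mem_layer.1 hθ
  rcases Nat.eq_zero_or_pos m with rfl | hm0
  · have : σ'.known 0 = ∅ := by
      refine Finset.eq_empty_of_forall_notMem fun x hx => ?_
      have := (hσ'.vExp_mem x 0 (by simpa using mem_known.1 hx)).1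
      omega
    rw [this]
    exact saturated_empty hC.2.1
  rw [label_cons] at heq hξ ⊢
  -- A variable of exponent `v ≤ m` was attached, in the iteration creating `C :: θ`, to the
  -- ancestor `θ.drop (v - 1)`, whose label is therefore still `C`. Coefficients placed there act on
  -- the transitions of `C` only.
  have hlab : ∀ j < m, label V (θ.drop j) = C := fun j hj => by
    simpa using hσ'.label_drop_eq hη'' (m := j + 1) hj heq
  have hθC : label V θ = C := by simpa using hlab 0 hm0
  have hanc : ∀ x ∈ σ'.known m, label V (ancestor θ (σ.level x)) = C := by
    intro x hx
    have hx := mem_known.1 hx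
    obtain ⟨v, hv⟩ := ENat.ne_top_iff_exists.1 (ne_top_of_le_ne_top (ENat.natCast_ne_top m) hx)
    rw [← hv] at hx
    have hvm : v ≤ m := by exact_mod_cast hx
    have h₁ := h.level_eq hv.symm
    have h₃ := hσ'.vExp_mem x v hv.symm
    have h₄ := h.ℓ_eq
    exact hlab _ (by omega)
  intro f χ hf hle t ht
  obtain ⟨K, hK⟩ := exists_nonneg_add_smul f g fun x => by
    by_cases hx : x ∈ σ'.known m
    · exact .inl (hg0 x hx)
    · exact .inr ⟨hf x hx, hg x hx⟩
  set f' := f + K • g with hf'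
  set χ' := χ + K • ξ with hχ'
  have hd : ∀ t ∈ C.transitions, drift f' χ' t = drift f χ t := fun t ht => by
    rw [hf', hχ', drift_add, drift_smul, hξ t ht, mul_zero, add_zero]
  have hf'0 : ∀ x ∉ σ'.known m, f' x = 0 := fun x hx => by
    simp [hf', hf x hx, hg x hx]
  -- Shifting by `c` makes the potential nonnegative on `C` without changing drifts there. Extending
  -- by zero is harmless, as the other labels of the layer share no state with `C`.
  let c : ℚ := ∑ q ∈ C.states, |χ' q|
  let χ'' : Q → ℚ := fun q => if q ∈ C.states then χ' q + c else 0
  let ρ' : Var → Node Q Var → ℚ := fun x η => if η = ancestor θ (σ.level x) then f' x else 0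
  have hloc : σ.localize ρ' θ = f' := by funext x; simp [localize, ρ']
  have hdC : ∀ t ∈ C.transitions, drift f' χ'' t = drift f χ t := by
    intro t ht
    rw [← hd t ht]
    simp only [drift, χ'', if_pos (C.src_mem t ht), if_pos (C.tgt_mem t ht)]
    ring
  have hsol : σ.IsRatSolution ρ' χ'' := by
    refine ⟨fun x η => ?_, fun q => ?_, fun η hη t ht => ?_⟩
    · simp only [ρ']
      split_ifs
      · exact hK x
      · exact le_rfl
    · simp only [χ'']
      split_ifs with hq
      · have h₁ : |χ' q| ≤ c :=
          Finset.single_le_sum (f := fun q => |χ' q|) (fun _ _ => abs_nonneg _) hq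
        have := neg_abs_le (χ' q)
        linarith
      · exact le_rfl
    · obtain ⟨hηt, hηlen⟩ := mem_layer.1 hη
      by_cases he : η = θ
      · subst he
        rw [hθC] at ht
        rw [hloc, hdC t ht]
        exact hle t ht
      · have hdisj : ∀ q ∈ (label V η).states, q ∉ C.states := fun q hq hqC =>
          he (hσ.eq_of_mem_states η hηt θ hθt (hηlen.trans hθlen.symm) q hq (hθC ▸ hqC))
        have hzero : σ.localize ρ' η = 0 := by
          funext x
          simp only [localize, ρ', Pi.zero_apply, ite_eq_right_iff]
          intro hxe
          by_contra hfx
          have hx : x ∈ σ'.known m := not_not.1 fun hx => hfx (hf'0 x hx)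
          have hsub : (label V η).IsSubVASS (label V (ancestor η (σ.level x))) :=
            (hσ.drop hηt _).2
          rw [hxe, hanc x hx] at hsub
          exact hdisj t.1 (VASS.src_mem _ t ht) (C.src_mem t (hsub.2 ht))
        rw [hzero, drift_zero]
        simp only [χ'', if_neg (hdisj _ (VASS.src_mem _ t ht)),
          if_neg (hdisj _ (VASS.tgt_mem _ t ht)), sub_zero, le_refl]
  -- A decreasing `t` would lie in `R` by optimality, yet `C` survives the removal of `R`.
  refine (hle t ht).eq_of_not_lt fun hlt => ?_
  refine (VASS.mem_removeTransitions.1 (hC.1.2 ht)).2 ?_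
  refine h.mem_of_drift_neg ρ' χ'' hsol θ hθ t (hθC ▸ ht) ?_
  rwa [hloc, hdC t ht]

end Step

end AlgState

end

/-! ### The potential and the timing of exponents -/

section

namespace AlgState

variable {Q Var : Type*} [Fintype Var] {V : VASS Q Var} {σ σ' : AlgState V}
  {R : Finset (Transition Q Var)} {ρ : Var → Node Q Var → ℚ} {ζ : Q → ℚ}

/-- An upper bound for the number of iterations in which the label below a node with label `S` can
still change before the next exponent of a variable is found. -/
def potential (σ : AlgState V) (P : ℕ) (S : VASS Q Var) : ℕ :=
  ∑ m ∈ Finset.range P, excess S (σ.known P) (σ.known m)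

theorem potential_le {P : ℕ} {S S' : VASS Q Var} (h : S'.IsSubVASS S) :
    σ.potential P S' ≤ σ.potential P S :=
  Finset.sum_le_sum fun _ _ => excess_le_of_isSubVASS h

/-- The quantitative invariant: `P` bounds the known exponents of variables, and `P + s` those of
transitions. -/
structure IsTimed (σ : AlgState V) (P s : ℕ) : Prop where
  vExp_le : ∀ x, σ.vExp x ≠ ⊤ → σ.vExp x ≤ P
  lt : P < σ.ℓ
  two_mul_le : 2 * (P + s) ≤ 2 ^ (σ.known P).card
  tExp_le : ∀ t, σ.tExp t ≠ ⊤ → σ.tExp t ≤ (P + s : ℕ)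
  potential_le : ∀ η ∈ σ.layer (σ.ℓ - 1), σ.potential P (label V η) ≤ s
  exists_last : ∀ η ∈ σ.layer (σ.ℓ - 1), ∃ e < σ.ℓ,
    label V (η.drop (σ.ℓ - 1 - e)) = label V η ∧ e + σ.potential P (label V η) ≤ P + s

namespace IsTimed

variable {P s : ℕ}

theorem known_subset (h : σ.IsTimed P s) (m : ℕ) : σ.known m ⊆ σ.known P := fun x hx => by
  rw [mem_known] at hx ⊢
  exact h.vExp_le x (ne_top_of_le_ne_top (ENat.natCast_ne_top m) hx)

theorem known_eq (h : σ.IsTimed P s) {m : ℕ} (hm : P ≤ m) : σ.known m = σ.known P :=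
  (h.known_subset m).antisymm (known_mono hm)

theorem eq_top_of_notMem (h : σ.IsTimed P s) {x : Var} (hx : x ∉ σ.known P) : σ.vExp x = ⊤ :=
  not_not.1 fun hne => hx (mem_known.2 (h.vExp_le x hne))

end IsTimed

theorem two_mul_le_two_pow {s : ℕ} (hs : 0 < s) : 2 * s ≤ 2 ^ s := by
  obtain ⟨n, rfl⟩ := Nat.exists_eq_succ_of_ne_zero hs.ne'
  have := Nat.lt_two_pow_self (n := n)
  rw [Nat.succ_eq_add_one, pow_succ]
  omega

namespace Step

variable {P s : ℕ}

open Classical in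
/-- An iteration that finds exponents of variables. -/
theorem isTimed_of_new (h : σ.Step σ' R ρ ζ) (hσ : σ.WellFormed) (hbal : σ'.IsBalanced)
    (ht : σ.IsTimed P s) (hℓ : σ.ℓ + s ≤ 2 ^ (σ.known P).card) {x : Var} (hx : σ.vExp x = ⊤)
    (hx0 : 0 < ρ x []) :
    σ'.IsTimed σ.ℓ (s + σ.ℓ * ((σ'.known σ.ℓ \ σ.known P).card - 1)) := by
  have hsub : σ.known P ⊆ σ'.known σ.ℓ := by
    rw [← h.known_eq ht.lt]
    exact known_mono ht.lt.le
  have hxA : x ∉ σ.known P := fun hm => by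
    rw [mem_known, hx, top_le_iff] at hm
    exact ENat.natCast_ne_top _ hm
  have hxA' : x ∈ σ'.known σ.ℓ := mem_known.2 (h.vExp_new x hx hx0).le
  set d := (σ'.known σ.ℓ \ σ.known P).card with hd
  have hd0 : 0 < d := Finset.card_pos.2 ⟨x, Finset.mem_sdiff.2 ⟨hxA', hxA⟩⟩
  have hcard : (σ'.known σ.ℓ).card = (σ.known P).card + d := by
    rw [hd, Finset.card_sdiff_of_subset hsub]
    have := Finset.card_le_card hsub
    omega
  have hmul : σ.ℓ * d = σ.ℓ * (d - 1) + σ.ℓ := by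
    obtain ⟨n, hn⟩ := Nat.exists_eq_succ_of_ne_zero hd0.ne'
    rw [hn, Nat.succ_sub_one, Nat.mul_succ]
  have hpot : ∀ η ∈ σ'.layer (σ'.ℓ - 1),
      σ'.potential σ.ℓ (label V η) ≤ s + σ.ℓ * (d - 1) := by
    intro η hη
    obtain ⟨g, hg, hg0⟩ := hbal η hη σ.ℓ
    obtain ⟨C, θ, hθ, hC, rfl⟩ := (h.mem_layer_last hσ).1 hη
    rw [label_cons] at hg ⊢
    have hle : σ'.potential σ.ℓ C ≤ ∑ m ∈ Finset.range σ.ℓ,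
        (excess C (σ.known P) (σ.known m) + (d - 1)) := by
      refine Finset.sum_le_sum fun m hm => ?_
      rw [h.known_eq (Finset.mem_range.1 hm)]
      exact excess_le_add hsub (ht.known_subset m) hg hxA' hxA (hg0 x hxA').ne'
    -- The summands with `P ≤ m` vanish, as no known exponent exceeds `P`; raising the range to
    -- `σ.ℓ` costs nothing.
    have htail : ∑ m ∈ Finset.range σ.ℓ, excess C (σ.known P) (σ.known m) = σ.potential P C := by
      refine (Finset.sum_subset (Finset.range_mono ht.lt.le) fun m _ hm => ?_).symm
      rw [ht.known_eq (not_lt.1 fun hlt => hm (Finset.mem_range.2 hlt)), excess_self]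
    rw [Finset.sum_add_distrib, htail, Finset.sum_const, Finset.card_range, smul_eq_mul] at hle
    have := (potential_le (σ := σ) (P := P)
      (hC.1.trans (VASS.removeTransitions_isSubVASS _ _))).trans (ht.potential_le θ hθ)
    omega
  refine ⟨fun y hy => ?_, by rw [h.ℓ_eq]; omega, ?_, fun t htt => ?_, hpot, fun η hη => ?_⟩
  · rcases h.vExp_cases y with ⟨he, -⟩ | ⟨-, -, he⟩
    · rw [he] at hy ⊢
      exact (ht.vExp_le y hy).trans (by exact_mod_cast ht.lt.le)
    · exact he.le
  · rw [hcard, pow_add]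
    calc 2 * (σ.ℓ + (s + σ.ℓ * (d - 1))) = 2 * (s + σ.ℓ * d) := by rw [hmul]; ring
      _ ≤ 2 * ((σ.ℓ + s) * d) := by
        have := Nat.le_mul_of_pos_right s hd0
        rw [add_mul]; omega
      _ = (σ.ℓ + s) * (2 * d) := by ring
      _ ≤ _ := Nat.mul_le_mul hℓ (two_mul_le_two_pow hd0)
  · by_cases hR : t.1 ∈ R
    · rw [h.tExp_new t hR]
      exact_mod_cast Nat.le_add_right _ _
    · rw [h.tExp_old t hR] at htt ⊢
      refine (ht.tExp_le t htt).trans ?_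
      have := ht.lt
      exact_mod_cast (by omega)
  · refine ⟨σ.ℓ, by rw [h.ℓ_eq]; omega, by simp [h.ℓ_eq], ?_⟩
    have := hpot η hη
    omega

/-- If no exponent of a variable is found, then the potential pays for the removal of
transitions. -/
theorem add_potential_le (h : σ.Step σ' R ρ ζ) (hσ : σ.WellFormed) (hsat : σ.IsSaturated)
    (ht : σ.IsTimed P s) (hold : ∀ x, ¬ (σ.vExp x = ⊤ ∧ 0 < ρ x [])) {η : Node Q Var}
    (hη : η ∈ σ.layer (σ.ℓ - 1)) {t : Transition Q Var} (htη : t ∈ (label V η).transitions)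
    (htR : t ∈ R) :
    σ.ℓ + σ.potential P ((label V η).removeTransitions R) ≤ P + s := by
  obtain ⟨hηt, hηlen⟩ := mem_layer.1 hη
  obtain ⟨e, heℓ, he, hes⟩ := ht.exists_last η hη
  -- The label has been constant on layers `e` to `σ.ℓ - 1`, so it is saturated for `known m`
  -- whenever `m ≤ σ.ℓ - 1 - e`.
  have hlt : ∀ m < σ.ℓ - e, excess ((label V η).removeTransitions R) (σ.known P) (σ.known m) <
      excess (label V η) (σ.known P) (σ.known m) := by
    intro m hm
    refine excess_lt_of_saturated (VASS.removeTransitions_isSubVASS _ _)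
      (hsat η hη m (by omega) (hσ.label_drop_eq hηt (by omega) he))
      (f := σ.localize ρ η) (ζ := ζ) (fun x hx => ?_) (h.isRatSolution.drift_nonpos η hη)
      ⟨t, htη, h.drift_neg η hη t htη htR⟩ fun t ht' => ?_
    · refine h.localize_eq_zero ?_ η
      rw [h.vExp_old x (hold x)]
      exact ht.eq_top_of_notMem hx
    · obtain ⟨h₁, h₂⟩ := VASS.mem_removeTransitions.1 ht'
      exact h.drift_eq_zero η hη t h₁ h₂
  -- At `m = P` the excess is zero and cannot drop, so all the strict drops occur among the summands
  -- of the potential.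
  have hP : σ.ℓ - e ≤ P := by
    by_contra hcon
    have := hlt P (not_le.1 hcon)
    rw [excess_self, excess_self] at this
    exact lt_irrefl _ this
  have hsum : σ.potential P ((label V η).removeTransitions R) + (σ.ℓ - e) ≤
      σ.potential P (label V η) := by
    have hcount : ∑ m ∈ Finset.range P, (if m < σ.ℓ - e then 1 else 0) = σ.ℓ - e := by
      rw [← Finset.sum_filter, Finset.sum_const, smul_eq_mul, mul_one]
      have : (Finset.range P).filter (· < σ.ℓ - e) = Finset.range (σ.ℓ - e) := by
        ext m
        simp only [Finset.mem_filter, Finset.mem_range]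
        omega
      rw [this, Finset.card_range]
    calc _ = ∑ m ∈ Finset.range P, (excess ((label V η).removeTransitions R) (σ.known P)
          (σ.known m) + if m < σ.ℓ - e then 1 else 0) := by
          rw [Finset.sum_add_distrib, hcount]; rfl
      _ ≤ _ := by
        refine Finset.sum_le_sum fun m _ => ?_
        split_ifs with hm
        · exact hlt m hm
        · exact excess_le_of_isSubVASS (VASS.removeTransitions_isSubVASS _ _)
  omega

/-- An iteration that finds no exponents of variables. -/
theorem isTimed_of_old (h : σ.Step σ' R ρ ζ) (hσ : σ.WellFormed) (hsat : σ.IsSaturated)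
    (ht : σ.IsTimed P s) (hold : ∀ x, ¬ (σ.vExp x = ⊤ ∧ 0 < ρ x [])) : σ'.IsTimed P s := by
  have hv : ∀ x, σ'.vExp x = σ.vExp x := fun x => h.vExp_old x (hold x)
  have hknown : ∀ m, σ'.known m = σ.known m := fun m => by ext x; simp only [mem_known, hv]
  have hpot : ∀ S, σ'.potential P S = σ.potential P S := fun S => by simp only [potential, hknown]
  refine ⟨fun x hx => ?_, by rw [h.ℓ_eq]; exact ht.lt.trans (Nat.lt_succ_self _), ?_,
    fun t htt => ?_, fun η hη => ?_, fun η hη => ?_⟩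
  · rw [hv] at hx ⊢
    exact ht.vExp_le x hx
  · rw [hknown]; exact ht.two_mul_le
  · by_cases hR : t.1 ∈ R
    · obtain ⟨η, hη, htη⟩ := AlgState.mem_U.1 (h.mem_U _ hR)
      have := h.add_potential_le hσ hsat ht hold hη htη hR
      rw [h.tExp_new t hR]
      exact_mod_cast (by omega : σ.ℓ ≤ P + s)
    · rw [h.tExp_old t hR] at htt ⊢
      exact ht.tExp_le t htt
  · obtain ⟨C, θ, hθ, hC, rfl⟩ := (h.mem_layer_last hσ).1 hη
    rw [hpot]
    exact (AlgState.potential_le (hC.1.trans (VASS.removeTransitions_isSubVASS _ _))).trans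
      (ht.potential_le θ hθ)
  · obtain ⟨C, θ, hθ, hC, rfl⟩ := (h.mem_layer_last hσ).1 hη
    rw [hpot, label_cons, h.ℓ_eq, Nat.add_sub_cancel]
    -- If the label loses a transition, the count restarts with `e = σ.ℓ`, paid for by the
    -- potential; otherwise the old `e` remains valid.
    by_cases hR : ∃ t ∈ (label V θ).transitions, t ∈ R
    · obtain ⟨t, htθ, htR⟩ := hR
      have h₁ := h.add_potential_le hσ hsat ht hold hθ htθ htR
      have h₂ : σ.potential P C ≤ _ := AlgState.potential_le hC.1
      exact ⟨σ.ℓ, by omega, by simp, by omega⟩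
    · push Not at hR
      have hCθ : C = label V θ :=
        hC.eq_of_disjoint (hσ.connected θ (mem_layer.1 hθ).1) hR
      obtain ⟨e, heℓ, he, hes⟩ := ht.exists_last θ hθ
      refine ⟨e, by omega, ?_, hCθ ▸ hes⟩
      have : σ.ℓ - e = σ.ℓ - 1 - e + 1 := by omega
      rw [this, List.drop_succ_cons, he, hCθ]

end Step

/-! ### The combined invariant and the final bound -/

/-- The invariant of the algorithm. -/
structure Invariant (σ : AlgState V) : Prop where
  wellFormed : σ.WellFormed
  hasPositiveSolution : σ.HasPositiveSolution
  isBalanced : σ.IsBalanced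
  isSaturated : σ.IsSaturated
  exists_isTimed : ∃ P s, σ.IsTimed P s ∧ σ.ℓ + s ≤ 2 ^ (σ.known P).card

theorem Invariant.init (hV : V.Connected) : (AlgState.init V).Invariant := by
  have hlayer : ∀ η, η ∈ (AlgState.init V).layer ((AlgState.init V).ℓ - 1) → η = [] := by
    intro η hη
    simpa [AlgState.init] using (mem_layer.1 hη).1
  have htop : ∀ x, (AlgState.init V).vExp x = ⊤ := fun _ => rfl
  have hknown : ∀ m, (AlgState.init V).known m = ∅ := fun m => by
    refine Finset.eq_empty_of_forall_notMem fun x hx => ?_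
    rw [mem_known, htop, top_le_iff] at hx
    exact ENat.natCast_ne_top _ hx
  refine ⟨WellFormed.init hV, ⟨0, 0, ⟨fun _ _ => le_rfl, fun _ => le_rfl, fun η _ t _ => ?_⟩,
    fun x hx => absurd (htop x) hx⟩, fun η hη m => ?_, fun η hη m _ _ => ?_,
    0, 0, ⟨fun x hx => absurd (htop x) hx, Nat.one_pos, by simp, fun t ht => absurd rfl ht,
      fun η _ => by simp [potential], fun η hη => ⟨0, Nat.one_pos, ?_, by simp [potential]⟩⟩, ?_⟩
  · exact (drift_zero (Var := Var) 0 t).trans (sub_self _) |>.le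
  · exact ⟨0, zero_mem _, fun x hx => by simp [hknown] at hx⟩
  · rw [hknown, hlayer η hη]
    exact saturated_empty hV
  · rw [hlayer η hη]; simp
  · rw [hknown]; simp [AlgState.init]

theorem Invariant.step (hσ : σ.Invariant) (h : σ.Step σ' R ρ ζ)
    (hrep : ∃ (x : Var) (t : V.transitions),
      (σ.ℓ : ℕ∞) < σ'.vExp x + σ'.tExp t ∧ σ'.vExp x + σ'.tExp t < ⊤) : σ'.Invariant := by
  have hbal := h.isBalanced hσ.wellFormed hσ.hasPositiveSolution hσ.isBalanced
  refine ⟨h.wellFormed hσ.wellFormed,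
    h.hasPositiveSolution hσ.wellFormed hσ.hasPositiveSolution, hbal,
    h.isSaturated hσ.wellFormed hbal, ?_⟩
  obtain ⟨P, s, ht, hℓ⟩ := hσ.exists_isTimed
  have key : ∃ P s, σ'.IsTimed P s := by
    by_cases hnew : ∃ x, σ.vExp x = ⊤ ∧ 0 < ρ x []
    · obtain ⟨x, hx, hx0⟩ := hnew
      exact ⟨_, _, h.isTimed_of_new hσ.wellFormed hbal ht hℓ hx hx0⟩
    · exact ⟨P, s, h.isTimed_of_old hσ.wellFormed hσ.isSaturated ht (not_exists.1 hnew)⟩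
  obtain ⟨P', s', ht'⟩ := key
  refine ⟨P', s', ht', ?_⟩
  -- The finite sum above `σ.ℓ` has summands at most `P'` and `P' + s'`, so `σ'.ℓ + s' ≤ 2 * (P' +
  -- s')`. This is where the factor 2 in `two_mul_le` is needed.
  obtain ⟨x, t, hlt, htop⟩ := hrep
  obtain ⟨hx, htt⟩ := WithTop.add_ne_top.1 htop.ne
  have hle := hlt.trans_le (add_le_add (ht'.vExp_le x hx) (ht'.tExp_le t htt))
  have hle' : σ.ℓ < P' + (P' + s') := by exact_mod_cast hle
  have := ht'.two_mul_le
  have := h.ℓ_eq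
  omega

theorem Invariant.body (hσ : σ.Invariant) {r : σ.varExt → ℤ} {z : V.states → ℤ}
    (hopt : σ.IsOptimal r z) (hexp : ¬ (σ.body r z).ReportsExponential) :
    (σ.body r z).incr.Invariant := by
  obtain ⟨ρ, ζ, h⟩ := exists_step hσ.wellFormed hopt
  exact hσ.step h (not_not.1 hexp)

end AlgState

theorem LoopHead.invariant {Q Var : Type*} [Fintype Var] {V : VASS Q Var} (hV : V.Connected)
    {σ : AlgState V} (h : LoopHead V σ) : σ.Invariant := by
  induction h with
  | init => exact AlgState.Invariant.init hV
  | next σ r z _ hopt hexp _ ih => exact ih.body hopt hexp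

end

end VASSBounds

end

theorem mainTheorem3 {Q Var : Type*} [Fintype Var] (V : VASSBounds.VASS Q Var)
    (hV : V.Connected) (vExp : Var → ℕ∞) (tExp : V.transitions → ℕ∞)
    (hrun : VASSBounds.Computes V vExp tExp) :
    (∀ x : Var, vExp x ≤ ((2 ^ Fintype.card Var : ℕ) : ℕ∞)) ∧
      ∀ t : V.transitions, tExp t ≤ ((2 ^ Fintype.card Var : ℕ) : ℕ∞) := by
  obtain ⟨σ, r, z, hσ, hopt, hexp, ⟨hv, ht⟩, rfl, rfl⟩ := hrun
  obtain ⟨P, s, hT, -⟩ := ((hσ.invariant hV).body hopt hexp).exists_isTimed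
  have h₁ := hT.two_mul_le
  have h₂ : 2 ^ ((σ.body r z).incr.known P).card ≤ 2 ^ Fintype.card Var :=
    Nat.pow_le_pow_right two_pos (Finset.card_le_univ _)
  exact ⟨fun x => (hT.vExp_le x (hv x)).trans (by exact_mod_cast (by omega)),
    fun t => (hT.tExp_le t (ht t)).trans (by exact_mod_cast (by omega))⟩
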